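/- Notation. For a finite group $G$, $\mathrm{Irr}(G)$ is the set of irreducible complex characters of $G$ and $\mathrm{Irr}_{2'}(G)$ the subset of those of odd degree. Let $M$ be a maximal ideal containing $2$ of the ring of all algebraic integers in $\mathbb{C}$. Characters $\chi,\psi\in\mathrm{Irr}(G)$ lie in the same $2$-block if $|K|\chi(x)/\chi(1)\equiv|K|\psi(x)/\psi(1) \pmod M$ for every conjugacy class $K$ of $G$ and $x\in K$; the principal $2$-block $B_0(G)$ is the block of the trivial character, $\mathrm{Irr}(B_0(G))$ is the set of $\chi\in\mathrm{Irr}(G)$ lying in it, and $\mathrm{Irr}_{2'}(B_0(G))=\mathrm{Irr}(B_0(G))\cap\mathrm{Irr}_{2'}(G)$. Let $\mathbb{Q}^{\mathrm{ab}}\subseteq\mathbb{C}$ be the maximal abelian extension of $\mathbb{Q}$, i.e. the field generated by all roots of unity, and let $\sigma\in\mathrm{Gal}(\mathbb{Q}^{\mathrm{ab}}/\mathbb{Q})$ be the unique element that fixes all roots of unity of $2$-power order and squares all roots of unity of odd order. A character $\chi$ (whose values lie in $\mathbb{Q}^{\mathrm{ab}}$) is $\sigma$-fixed if $\sigma(\chi(g))=\chi(g)$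 for all $g\in G$. For $N\lhd G$, a subscript $G/N$ denotes the subset of characters of $N$ invariant under the action of $G/N$ induced by conjugation. Lemma. Let $G$ be a finite group with a normal subgroup $N\lhd G$ such that $G/N$ is a $2$-group, and let $\chi\in\mathrm{Irr}_{2'}(G)$. Then $\mathrm{Res}^G_N(\chi)\in\mathrm{Irr}_{2'}(N)_{G/N}$; in particular it is irreducible. Furthermore, $\chi\in\mathrm{Irr}_{2'}(B_0(G))$ if and only if $\mathrm{Res}^G_N(\chi)\in\mathrm{Irr}_{2'}(B_0(N))_{G/N}$, and $\chi$ is $\sigma$-fixed if and only if $\mathrm{Res}^G_N(\chi)$ is $\sigma$-fixed. -/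

import Mathlib

namespace OddDegreeRestriction

/-- The maximal abelian extension `ℚ^ab` of `ℚ` inside `ℂ`, in the form given by the
Kronecker-Weber theorem: the field generated over `ℚ` by all complex roots of unity. -/
noncomputable def Qab : IntermediateField ℚ ℂ :=
  IntermediateField.adjoin ℚ {z : ℂ | ∃ n : ℕ, n ≠ 0 ∧ z ^ n = 1}

theorem mem_Qab_of_pow_eq_one {z : ℂ} {n : ℕ} (hn : n ≠ 0) (hz : z ^ n = 1) : z ∈ Qab :=
  IntermediateField.subset_adjoin ℚ _ ⟨n, hn, hz⟩

theorem exists_isPrimitiveRoot_Qab {n : ℕ} (hn : n ≠ 0) : ∃ ζ : Qab, IsPrimitiveRoot ζ n := by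
  have h := Complex.isPrimitiveRoot_exp n hn
  refine ⟨⟨_, mem_Qab_of_pow_eq_one hn h.pow_eq_one⟩, ?_⟩
  exact IsPrimitiveRoot.of_map_of_injective (f := algebraMap Qab ℂ) h
    (algebraMap Qab ℂ).injective

theorem isGalois_Qab : IsGalois ℚ Qab := by
  have hint : Algebra.IsAlgebraic ℚ Qab := by
    refine IntermediateField.isAlgebraic_adjoin fun z hz => ?_
    obtain ⟨n, hn, h⟩ := hz
    exact IsIntegral.of_pow (Nat.pos_of_ne_zero hn) (h ▸ isIntegral_one)
  have hgen : IntermediateField.adjoin ℚ {z : Qab | ∃ n ∈ (Set.univ : Set ℕ), n ≠ 0 ∧ z ^ n = 1}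
      = ⊤ := by
    rw [eq_top_iff]
    rintro ⟨x, hx⟩ -
    refine IntermediateField.adjoin_induction ℚ
      (p := fun y hy => (⟨y, hy⟩ : Qab) ∈ IntermediateField.adjoin ℚ
        {z : Qab | ∃ n ∈ (Set.univ : Set ℕ), n ≠ 0 ∧ z ^ n = 1}) ?_ ?_ ?_ ?_ ?_ hx
    · rintro z ⟨n, hn, hz⟩
      exact IntermediateField.subset_adjoin ℚ _ ⟨n, trivial, hn, Subtype.ext hz⟩
    · intro q
      have : (⟨algebraMap ℚ ℂ q, Qab.algebraMap_mem q⟩ : Qab) = algebraMap ℚ Qab q :=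
        Subtype.ext (by simp)
      exact this ▸ IntermediateField.algebraMap_mem _ q
    · exact fun _ _ _ _ h h' => add_mem h h'
    · exact fun _ _ h => inv_mem h
    · exact fun _ _ _ _ h h' => mul_mem h h'
  have : IsCyclotomicExtension (Set.univ : Set ℕ) ℚ Qab := by
    rw [IsCyclotomicExtension.iff_adjoin_eq_top]
    refine ⟨fun n _ hn => exists_isPrimitiveRoot_Qab hn, ?_⟩
    rw [← IntermediateField.adjoin_toSubalgebra_of_isAlgebraic, hgen]
    · rfl
    · intro z hz
      exact Algebra.IsAlgebraic.isAlgebraic z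
  exact IsCyclotomicExtension.isGalois Set.univ ℚ Qab

/-- The defining property of the Galois automorphism `σ`: it fixes the roots of unity of
`2`-power order and squares the roots of unity of odd order. -/
def IsSigma (τ : Qab ≃ₐ[ℚ] Qab) : Prop :=
  (∀ (z : Qab) (k : ℕ), z ^ 2 ^ k = 1 → τ z = z) ∧
    ∀ (z : Qab) (m : ℕ), Odd m → z ^ m = 1 → τ z = z ^ 2

theorem isClosed_setOf_apply_eq (z w : Qab) : IsClosed {τ : Qab ≃ₐ[ℚ] Qab | τ z = w} := by
  have := isGalois_Qab
  by_cases h : ∃ τ₀ : Qab ≃ₐ[ℚ] Qab, τ₀ z = w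
  · obtain ⟨τ₀, rfl⟩ := h
    have hst : IsClosed (MulAction.stabilizer (Qab ≃ₐ[ℚ] Qab) z : Set (Qab ≃ₐ[ℚ] Qab)) :=
      Subgroup.isClosed_of_isOpen _ (stabilizer_isOpen_of_isIntegral z)
    have := hst.preimage (continuous_const_mul τ₀⁻¹)
    convert this using 1
    ext τ
    simp only [Set.mem_ofPred_eq, Set.mem_preimage, SetLike.mem_coe, MulAction.mem_stabilizer_iff,
      mul_smul, inv_smul_eq_iff]
    rfl
  · convert isClosed_empty
    ext τ
    simp only [Set.mem_ofPred_eq, Set.mem_empty_iff_false, iff_false]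
    exact fun hτ => h ⟨τ, hτ⟩

theorem exists_finite_level (n : ℕ) {m : ℕ} (hm : Odd m) : ∃ τ : Qab ≃ₐ[ℚ] Qab,
    (∀ z : Qab, z ^ 2 ^ n = 1 → τ z = z) ∧ ∀ z : Qab, z ^ m = 1 → τ z = z ^ 2 := by
  have := isGalois_Qab
  have hcop : Nat.Coprime (2 ^ n) m := (Nat.coprime_two_left.2 hm).pow_left n
  have hm0 : m ≠ 0 := hm.pos.ne'
  have hN : 2 ^ n * m ≠ 0 := by positivity
  obtain ⟨k, hk1, hk2⟩ := Nat.chineseRemainder hcop 1 2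
  have hkN : Nat.Coprime k (2 ^ n * m) := by
    refine Nat.Coprime.mul_right ?_ ?_
    · rw [Nat.Coprime, hk1.gcd_eq]; simp
    · rw [Nat.Coprime, hk2.gcd_eq]; exact Nat.coprime_two_left.2 hm
  obtain ⟨ζ, hζ⟩ := exists_isPrimitiveRoot_Qab hN
  have : NeZero (2 ^ n * m) := ⟨hN⟩
  have hζi : IsIntegral ℤ ζ := hζ.isIntegral (Nat.pos_of_ne_zero hN)
  have hconj : IsConjRoot ℚ (ζ ^ k) ζ := by
    rw [isConjRoot_def, minpoly.isIntegrallyClosed_eq_field_fractions' ℚ hζi,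
      minpoly.isIntegrallyClosed_eq_field_fractions' ℚ (hζi.pow k),
      hζ.minpoly_eq_pow_coprime hkN]
  obtain ⟨τ, hτ⟩ := hconj.exists_algEquiv
  have key : ∀ z : Qab, z ^ (2 ^ n * m) = 1 → τ z = z ^ k := by
    intro z hz
    obtain ⟨i, -, rfl⟩ := hζ.eq_pow_of_pow_eq_one hz
    rw [map_pow, hτ, ← pow_mul, ← pow_mul, mul_comm]
  refine ⟨τ, fun z hz => ?_, fun z hz => ?_⟩
  · rw [key z (by rw [pow_mul, hz, one_pow])]
    simpa using pow_eq_pow_of_modEq hk1 hz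
  · rw [key z (by rw [mul_comm, pow_mul, hz, one_pow])]
    exact pow_eq_pow_of_modEq hk2 hz

theorem exists_isSigma : ∃ τ : Qab ≃ₐ[ℚ] Qab, IsSigma τ := by
  have := isGalois_Qab
  let M : ℕ → ℕ := fun n => ∏ i ∈ Finset.range n, (2 * i + 1)
  have hM : ∀ n, Odd (M n) := fun n =>
    Finset.prod_induction _ Odd (fun _ _ => Odd.mul) odd_one fun i _ => ⟨i, rfl⟩
  let T : ℕ → Set (Qab ≃ₐ[ℚ] Qab) := fun n =>
    {τ | (∀ z : Qab, z ^ 2 ^ n = 1 → τ z = z) ∧ ∀ z : Qab, z ^ M n = 1 → τ z = z ^ 2}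
  have hcl : ∀ n, IsClosed (T n) := by
    intro n
    have : T n = (⋂ (z : Qab) (_ : z ^ 2 ^ n = 1), {τ | τ z = z}) ∩
        ⋂ (z : Qab) (_ : z ^ M n = 1), {τ | τ z = z ^ 2} := by
      ext τ
      simp [T]
    rw [this]
    exact (isClosed_iInter fun z => isClosed_iInter fun _ => isClosed_setOf_apply_eq z z).inter
      (isClosed_iInter fun z => isClosed_iInter fun _ => isClosed_setOf_apply_eq z _)
  obtain ⟨τ, hτ⟩ := IsCompact.nonempty_iInter_of_sequence_nonempty_isCompact_isClosed T
    (fun n τ hτ => ⟨fun z hz => hτ.1 z (by rw [pow_succ, pow_mul, hz, one_pow]),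
      fun z hz => hτ.2 z (by simp only [M, Finset.prod_range_succ, pow_mul] at hz ⊢
                             rw [hz, one_pow])⟩)
    (fun n => exists_finite_level n (hM n)) (hcl 0).isCompact hcl
  rw [Set.mem_iInter] at hτ
  refine ⟨τ, fun z k hz => (hτ k).1 z hz, fun z m hm hz => ?_⟩
  obtain ⟨i, rfl⟩ := hm
  refine (hτ (i + 1)).2 z ?_
  obtain ⟨c, hc⟩ : (2 * i + 1) ∣ M (i + 1) :=
    Finset.dvd_prod_of_mem (fun i => 2 * i + 1) (Finset.self_mem_range_succ i)
  rw [hc, pow_mul, hz, one_pow]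

theorem IsSigma.unique {τ τ' : Qab ≃ₐ[ℚ] Qab} (h : IsSigma τ) (h' : IsSigma τ') : τ = τ' := by
  have key : (τ : Qab →ₐ[ℚ] Qab) = (τ' : Qab →ₐ[ℚ] Qab) := by
    refine IntermediateField.algHom_ext_of_eq_adjoin (S := Qab) ℚ rfl ?_
    rintro z ⟨n, hn, hzn⟩
    obtain ⟨k, m, hm, rfl⟩ := Nat.exists_eq_two_pow_mul_odd hn
    have hz : z ∈ Qab := mem_Qab_of_pow_eq_one hn hzn
    change τ ⟨z, hz⟩ = τ' ⟨z, hz⟩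
    have hzn' : (⟨z, hz⟩ : Qab) ^ (2 ^ k * m) = 1 := Subtype.ext hzn
    generalize (⟨z, hz⟩ : Qab) = y at hzn'
    have hy0 : y ≠ 0 := by
      rintro rfl
      rw [zero_pow hn] at hzn'
      exact zero_ne_one hzn'
    obtain ⟨a, b, hab⟩ : IsCoprime ((2 ^ k : ℕ) : ℤ) (m : ℤ) :=
      Nat.isCoprime_iff_coprime.2 ((Nat.coprime_two_left.2 hm).pow_left k)
    have e1 : τ (y ^ m) = τ' (y ^ m) := by
      have : (y ^ m) ^ 2 ^ k = 1 := by rw [← pow_mul, mul_comm, hzn']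
      rw [h.1 _ k this, h'.1 _ k this]
    have e2 : τ (y ^ 2 ^ k) = τ' (y ^ 2 ^ k) := by
      have : (y ^ 2 ^ k) ^ m = 1 := by rw [← pow_mul, hzn']
      rw [h.2 _ m hm this, h'.2 _ m hm this]
    have hy : y = (y ^ 2 ^ k) ^ a * (y ^ m) ^ b := by
      rw [← zpow_natCast, ← zpow_natCast, ← zpow_mul, ← zpow_mul, ← zpow_add₀ hy0,
        mul_comm, mul_comm _ b, hab, zpow_one]
    rw [hy, map_mul, map_mul, map_zpow₀, map_zpow₀, map_zpow₀, map_zpow₀, e1, e2]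
  exact AlgEquiv.ext fun x => DFunLike.congr_fun key x

/-- The unique `σ ∈ Gal(ℚ^ab/ℚ)` that fixes the roots of unity of `2`-power order and squares
those of odd order. -/
noncomputable def sigma : Qab ≃ₐ[ℚ] Qab :=
  Classical.choose exists_isSigma

theorem isSigma_sigma : IsSigma sigma :=
  Classical.choose_spec exists_isSigma

section Characters

variable (G : Type*) [Group G]

/-- `Irr(G)`: the characters of the irreducible finite-dimensional complex representations of `G`,
as functions `G → ℂ`. -/
def Irr : Set (G → ℂ) :=
  {χ | ∃ (n : ℕ) (ρ : Representation ℂ G (Fin n → ℂ)), ρ.IsIrreducible ∧ ρ.character = χ}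

/-- `Irr_{2'}(G)`: the irreducible characters of odd degree. -/
def IrrOdd : Set (G → ℂ) :=
  {χ | χ ∈ Irr G ∧ ∃ d : ℕ, Odd d ∧ χ 1 = d}

variable {G}

/-- The value `ω_χ(K̂) = |K| χ(x) / χ(1)` of the central character of `χ` at the sum `K̂` of the
conjugacy class `K` of `x`. -/
noncomputable def centralCharacter (χ : G → ℂ) (x : G) : ℂ :=
  (Nat.card (ConjClasses.mk x).carrier : ℂ) * χ x / χ 1

/-- Congruence of complex numbers modulo an ideal of the ring of all algebraic integers. -/
def CongrMod (M : Ideal (integralClosure ℤ ℂ)) (a b : ℂ) : Prop :=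
  ∃ r : integralClosure ℤ ℂ, r ∈ M ∧ a - b = (r : ℂ)

/-- Two irreducible characters lie in the same `2`-block of `G` if their central characters
agree modulo `M`, a fixed maximal ideal containing `2` of the ring of algebraic integers. -/
def SameBlock (M : Ideal (integralClosure ℤ ℂ)) (χ ψ : G → ℂ) : Prop :=
  ∀ x : G, CongrMod M (centralCharacter χ x) (centralCharacter ψ x)

/-- `Irr(B₀(G))`: the irreducible characters in the principal `2`-block, that is, in the block of
the trivial character. -/
def IrrB0 (M : Ideal (integralClosure ℤ ℂ)) (G : Type*) [Group G] : Set (G → ℂ) :=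
  {χ | χ ∈ Irr G ∧ SameBlock M χ (fun _ => 1)}

/-- `Irr_{2'}(B₀(G)) = Irr(B₀(G)) ∩ Irr_{2'}(G)`. -/
def IrrOddB0 (M : Ideal (integralClosure ℤ ℂ)) (G : Type*) [Group G] : Set (G → ℂ) :=
  IrrB0 M G ∩ IrrOdd G

/-- The functions on the normal subgroup `N` that are invariant under conjugation by `G`
(for class functions of `N` this is invariance under the induced action of `G/N`). -/
def Invariant (N : Subgroup G) [N.Normal] : Set (N → ℂ) :=
  {φ | ∀ (g : G) (n : N), φ (MulAut.conjNormal g n) = φ n}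

/-- The restriction of a function on `G` to a subgroup. -/
def Res (N : Subgroup G) (χ : G → ℂ) : N → ℂ :=
  fun n => χ n

/-- `χ` has values in `ℚ^ab` that are all fixed by `σ`, i.e. `χ^σ = χ`. -/
def SigmaFixed (χ : G → ℂ) : Prop :=
  ∀ g : G, ∃ z : Qab, (z : ℂ) = χ g ∧ sigma z = z

end Characters

end OddDegreeRestriction

namespace OddDegreeRestriction

open Module

/-! Since `G/N` is a 2-group, a subgroup of index 2 containing `N` exists whenever `N` is proper,
and induction reduces everything to a subgroup `H` of index 2. There, restriction stays irreducible:
a counterexample would split `V` as `U ⊕ gU`, of even dimension. Invariance holds because `χ` is a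
class function.

The main tool is Schur's lemma for `H`: any function on `G`, supported in `H` or not, that is
invariant under conjugation by `H` acts on `V` as a scalar. So the normalized class sum `ω` is
multiplicative on sums over `H`-orbits in all of `G` (`sum_mul_character_mul_sum_mul_character`).

Principal block, down: for `y ∈ H` and `g ∉ H`, the product of the `H`-class sums of `y` and `gyg⁻¹`
is invariant under `G`. Its `ω` is the square of that of `y`, and the block hypothesis on `G` makes
it congruent to the squared class size. Squaring is injective modulo a prime containing 2. Principal
block, up: inside `H` the values of `ω` differ by an integer factor. For `x ∉ H`, either the class
size is even and both sides vanish modulo `M`, or the congruence for `x ^ 2 ∈ H` is pulled back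
along squaring.

`σ`-fixedness, up: for `x ∉ H` the 2-part `y` of `x` also lies outside `H`, and `χ y` is a `σ`-fixed
nonzero number. The product of the two orbit sums is supported on `H`, so it determines `χ x` from
`σ`-fixed data. -/

/-- An endomorphism of finite order of a complex vector space is diagonalizable, and its
eigenvalues are roots of unity. -/
theorem exists_eigenvalues_of_pow_eq_one {V : Type*} [AddCommGroup V] [Module ℂ V]
    [FiniteDimensional ℂ V] {A : End ℂ V} {m : ℕ} (hm : m ≠ 0) (hA : A ^ m = 1) :
    ∃ μ : Fin (finrank ℂ V) → ℂ, (∀ i, μ i ^ m = 1) ∧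
      ∀ j : ℕ, LinearMap.trace ℂ V (A ^ j) = ∑ i, μ i ^ j := by
  classical
  -- `X ^ m - 1` is separable in characteristic zero.
  have hss : A.IsSemisimple := by
    refine End.isSemisimple_of_squarefree_aeval_eq_zero
      (p := (Polynomial.X ^ m - Polynomial.C (1 : ℂ))) ?_ (by simp [hA])
    exact (Polynomial.separable_X_pow_sub_C (1 : ℂ) (by exact_mod_cast hm) one_ne_zero).squarefree
  have htop : ⨆ μ : ℂ, A.eigenspace μ = ⊤ :=
    hss.iSup_maxGenEigenspace_eq_top_iff.1 (End.iSup_maxGenEigenspace_eq_top A)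
  have hint : DirectSum.IsInternal fun μ : ℂ => A.eigenspace μ :=
    (DirectSum.isInternal_submodule_iff_iSupIndep_and_iSup_eq_top _).2
      ⟨A.eigenspaces_iSupIndep, htop⟩
  let b₀ := hint.collectedBasis fun μ => finBasis ℂ (A.eigenspace μ)
  have : Fintype (Σ μ : ℂ, Fin (finrank ℂ (A.eigenspace μ))) :=
    FiniteDimensional.fintypeBasisIndex b₀
  let e := Fintype.equivFinOfCardEq (finrank_eq_card_basis b₀).symm
  let b := b₀.reindex e
  let μ : Fin (finrank ℂ V) → ℂ := fun i => (e.symm i).1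
  have hb : ∀ i, A (b i) = μ i • b i := fun i => by
    rw [← End.mem_eigenspace_iff, Basis.reindex_apply]
    exact hint.collectedBasis_mem _ _
  have hbj : ∀ (j : ℕ) i, (A ^ j) (b i) = μ i ^ j • b i := fun j i => by
    induction j with
    | zero => simp
    | succ j ih => rw [pow_succ', End.mul_apply, ih, map_smul, hb, smul_smul, pow_succ]
  refine ⟨μ, fun i => ?_, fun j => ?_⟩
  · have h := hbj m i
    rw [hA, End.one_apply] at h
    exact smul_left_injective ℂ (b.ne_zero i) (by simpa using h.symm)
  · rw [LinearMap.trace_eq_matrix_trace ℂ b, Matrix.trace]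
    refine Finset.sum_congr rfl fun i _ => ?_
    simp [LinearMap.toMatrix_apply, hbj]

/-! ### Irreducibility on a subgroup of index two -/

section

variable {G V : Type*} [Group G] [AddCommGroup V] [Module ℂ V]

theorem eq_bot_or_eq_top_of_isIrreducible {ρ : Representation ℂ G V} (hρ : ρ.IsIrreducible)
    (U : Submodule ℂ V) (hU : ∀ g, U.map (ρ g) ≤ U) : U = ⊥ ∨ U = ⊤ := by
  let W : Subrepresentation ρ := ⟨U, fun g v hv => hU g ⟨v, hv, rfl⟩⟩
  rcases eq_bot_or_eq_top W with h | h
  · exact Or.inl (congrArg Subrepresentation.toSubmodule h)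
  · exact Or.inr (congrArg Subrepresentation.toSubmodule h)

theorem isIrreducible_of_forall_submodule [Nontrivial V] {ρ : Representation ℂ G V}
    (h : ∀ U : Submodule ℂ V, (∀ g, U.map (ρ g) ≤ U) → U = ⊥ ∨ U = ⊤) : ρ.IsIrreducible := by
  have : Nontrivial (Subrepresentation ρ) := by
    refine ⟨⊥, ⊤, fun hbt => ?_⟩
    exact bot_ne_top (congrArg Subrepresentation.toSubmodule hbt : (⊥ : Submodule ℂ V) = ⊤)
  refine ⟨fun W => ?_⟩
  rcases h W.toSubmodule (by rintro g _ ⟨v, hv, rfl⟩; exact W.apply_mem_toSubmodule g hv) with h | h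
  · exact Or.inl (Subrepresentation.toSubmodule_injective h)
  · exact Or.inr (Subrepresentation.toSubmodule_injective h)

theorem isIrreducible_comp_of_surjective {K : Type*} [Group K] [Nontrivial V]
    {ρ : Representation ℂ G V} (hρ : ρ.IsIrreducible) (f : K →* G) (hf : Function.Surjective f) :
    Representation.IsIrreducible (ρ.comp f : Representation ℂ K V) := by
  refine isIrreducible_of_forall_submodule fun U hU => ?_
  refine eq_bot_or_eq_top_of_isIrreducible hρ U fun g => ?_
  obtain ⟨k, rfl⟩ := hf g
  exact hU k

/-- Elements outside `H` interchange `U` and `gU`, so their intersection and sum are stable under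
`G`. The only case not forcing `U` to be trivial is `V = U ⊕ gU`, excluded by parity. -/
theorem isIrreducible_comp_subtype_of_index_two [FiniteDimensional ℂ V]
    {ρ : Representation ℂ G V} (hρ : ρ.IsIrreducible) (hV : Odd (finrank ℂ V)) {H : Subgroup G}
    (hH : H.index = 2) :
    Representation.IsIrreducible (ρ.comp H.subtype : Representation ℂ H V) := by
  have : Nontrivial V := nontrivial_of_finrank_pos (R := ℂ) hV.pos
  refine isIrreducible_of_forall_submodule fun U hU => ?_
  obtain ⟨g, hg⟩ : ∃ g, g ∉ H := by
    by_contra! h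
    rw [(Subgroup.eq_top_iff' H).2 h, Subgroup.index_top] at hH
    omega
  have hmap : ∀ a b, U.map (ρ (a * b)) = (U.map (ρ b)).map (ρ a) := fun a b => by
    rw [map_mul, End.mul_eq_comp, Submodule.map_comp]
  have hin : ∀ k ∈ H, U.map (ρ k) ≤ U := fun k hk => hU ⟨k, hk⟩
  have hout : ∀ k, k ∉ H → U.map (ρ k) ≤ U.map (ρ g) := fun k hk => by
    have : k = g * (g⁻¹ * k) := by group
    rw [this, hmap]
    refine Submodule.map_mono (hin _ ?_)
    rw [Subgroup.mul_mem_iff_of_index_two hH, inv_mem_iff]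
    tauto
  have hU1 : ∀ k, k ∈ H → (U.map (ρ g)).map (ρ k) ≤ U.map (ρ g) := fun k hk => by
    rw [← hmap]
    exact hout _ (by rw [Subgroup.mul_mem_iff_of_index_two hH]; tauto)
  have hU2 : ∀ k, k ∉ H → (U.map (ρ g)).map (ρ k) ≤ U := fun k hk => by
    rw [← hmap]
    exact hin _ (by rw [Subgroup.mul_mem_iff_of_index_two hH]; tauto)
  have hinf := eq_bot_or_eq_top_of_isIrreducible hρ (U ⊓ U.map (ρ g)) fun k => by
    refine (Submodule.map_inf_le _).trans ?_
    by_cases hk : k ∈ H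
    · exact inf_le_inf (hin k hk) (hU1 k hk)
    · rw [inf_comm]
      exact inf_le_inf (hU2 k hk) (hout k hk)
  have hsup := eq_bot_or_eq_top_of_isIrreducible hρ (U ⊔ U.map (ρ g)) fun k => by
    rw [Submodule.map_sup]
    by_cases hk : k ∈ H
    · exact sup_le_sup (hin k hk) (hU1 k hk)
    · rw [sup_comm]
      exact sup_le_sup (hU2 k hk) (hout k hk)
  rcases hsup with hsup | hsup
  · exact Or.inl (le_bot_iff.1 (hsup ▸ le_sup_left))
  rcases hinf with hinf | hinf
  · exfalso
    have hdim := Submodule.finrank_sup_add_finrank_inf_eq U (U.map (ρ g))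
    have hinj : Function.Injective (ρ g) := Function.LeftInverse.injective (g := ρ g⁻¹) fun v => by
      rw [← End.mul_apply, ← map_mul, inv_mul_cancel, map_one, End.one_apply]
    rw [hsup, hinf, finrank_top, finrank_bot,
      ← (Submodule.equivMapOfInjective (ρ g) hinj U).finrank_eq] at hdim
    obtain ⟨r, hr⟩ := hV
    omega
  · exact Or.inr (top_le_iff.1 (hinf ▸ inf_le_left))

theorem exists_eq_smul_one_of_commute [FiniteDimensional ℂ V] {ρ : Representation ℂ G V}
    (hρ : ρ.IsIrreducible) (T : End ℂ V) (hT : ∀ g, T * ρ g = ρ g * T) : ∃ c : ℂ, T = c • 1 := by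
  let f : Representation.IntertwiningMap ρ ρ := ⟨T, hT⟩
  have := hρ
  obtain ⟨c, hc⟩ :=
    (Representation.IsIrreducible.algebraMap_intertwiningMap_bijective_of_isAlgClosed (ρ := ρ)).2 f
  exact ⟨c, (congrArg (fun f : Representation.IntertwiningMap ρ ρ => f.toLinearMap) hc).symm⟩

end

/-! ### Divisibility of conjugacy class sizes -/

theorem natCard_carrier_eq_index_centralizer {G : Type*} [Group G] (x : G) :
    Nat.card (ConjClasses.mk x).carrier = (Subgroup.centralizer {x}).index := by
  rw [← ConjAct.orbit_eq_carrier_conjClasses, Nat.card_coe_set_eq, ← MulAction.index_stabilizer,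
    Subgroup.centralizer_eq_comap_stabilizer]
  exact (Subgroup.index_comap_of_surjective _ (f := (ConjAct.toConjAct (G := G)).toMonoidHom)
    ConjAct.toConjAct.surjective).symm

theorem natCard_carrier_pow_dvd {G : Type*} [Group G] (x : G) (n : ℕ) :
    Nat.card (ConjClasses.mk (x ^ n)).carrier ∣ Nat.card (ConjClasses.mk x).carrier := by
  rw [natCard_carrier_eq_index_centralizer, natCard_carrier_eq_index_centralizer]
  refine Subgroup.index_dvd_of_le fun g hg => ?_
  rw [Subgroup.mem_centralizer_singleton_iff] at hg ⊢
  exact (Commute.pow_right (show Commute g x from hg) n).eq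

/-- With `C` the centralizer in `G`, the quotient of the two sizes is `|G : H| / |C : C ∩ H|`, an
integer because `H` is normal. -/
theorem natCard_carrier_subgroup_dvd {G : Type*} [Group G] [Finite G] (H : Subgroup G) [H.Normal] (x : H) :
    Nat.card (ConjClasses.mk x).carrier ∣ Nat.card (ConjClasses.mk (x : G)).carrier := by
  rw [natCard_carrier_eq_index_centralizer, natCard_carrier_eq_index_centralizer]
  have : Subgroup.centralizer {x} = (Subgroup.centralizer {(x : G)}).subgroupOf H := by
    ext h
    simp only [Subgroup.mem_subgroupOf, Subgroup.mem_centralizer_singleton_iff, Subtype.ext_iff,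
      Subgroup.coe_mul]
  rw [this, ← Subgroup.relIndex, ← Subgroup.inf_relIndex_right]
  set C := Subgroup.centralizer {(x : G)}
  obtain ⟨m, hm⟩ := H.relIndex_dvd_index_of_normal C
  have h1 := Subgroup.relIndex_mul_index (inf_le_right : C ⊓ H ≤ H)
  have h2 := Subgroup.relIndex_mul_index (inf_le_left : C ⊓ H ≤ C)
  rw [Subgroup.inf_relIndex_left] at h2
  refine ⟨m, Nat.eq_of_mul_eq_mul_left 
    (Nat.pos_of_ne_zero (Subgroup.index_ne_zero_of_finite (H := H.subgroupOf C))) ?_⟩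
  change H.relIndex C * C.index = H.relIndex C * ((C ⊓ H).relIndex H * m)
  rw [h2, ← h1, hm]
  ring

/-! ### Orbits under conjugation by a subgroup, and convolution -/

section

variable {G : Type*} [Group G] (H : Subgroup G)

/-- The orbit of `y` under conjugation by the subgroup `H`. -/
def conjOrbit (y : G) : Set G :=
  {u | ∃ h ∈ H, h * y * h⁻¹ = u}

theorem self_mem_conjOrbit (y : G) : y ∈ conjOrbit H y :=
  ⟨1, H.one_mem, by simp⟩

variable {H}

theorem conjOrbit_conj_eq {h : G} (hh : h ∈ H) (y : G) :
    conjOrbit H (h * y * h⁻¹) = conjOrbit H y := by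
  ext u
  constructor
  · rintro ⟨k, hk, rfl⟩
    exact ⟨k * h, H.mul_mem hk hh, by group⟩
  · rintro ⟨k, hk, rfl⟩
    exact ⟨k * h⁻¹, H.mul_mem hk (H.inv_mem hh), by group⟩

theorem conj_mem_conjOrbit_conj_iff [hH : H.Normal] (g y u : G) :
    g * u * g⁻¹ ∈ conjOrbit H (g * y * g⁻¹) ↔ u ∈ conjOrbit H y := by
  constructor
  · rintro ⟨k, hk, h⟩
    refine ⟨g⁻¹ * k * g, by simpa using hH.conj_mem k hk g⁻¹, ?_⟩
    calc g⁻¹ * k * g * y * (g⁻¹ * k * g)⁻¹ = g⁻¹ * (k * (g * y * g⁻¹) * k⁻¹) * g := by group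
      _ = u := by rw [h]; group
  · rintro ⟨k, hk, rfl⟩
    exact ⟨g * k * g⁻¹, hH.conj_mem k hk g, by group⟩

theorem conj_mem_conjOrbit_iff [H.Normal] {h : G} (hh : h ∈ H) (y u : G) :
    h * u * h⁻¹ ∈ conjOrbit H y ↔ u ∈ conjOrbit H y := by
  rw [← conjOrbit_conj_eq hh y, conj_mem_conjOrbit_conj_iff, conjOrbit_conj_eq hh y]

theorem mem_iff_mem_of_mem_conjOrbit {y u : G} (hu : u ∈ conjOrbit H y) : u ∈ H ↔ y ∈ H := by
  obtain ⟨h, hh, rfl⟩ := hu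
  rw [H.mul_mem_cancel_right (H.inv_mem hh), H.mul_mem_cancel_left hh]

theorem ncard_conjOrbit (y : H) :
    (conjOrbit H (y : G)).ncard = Nat.card (ConjClasses.mk y).carrier := by
  have : conjOrbit H (y : G) = Subtype.val '' (ConjClasses.mk y).carrier := by
    ext u
    simp only [Set.mem_image, ConjClasses.mem_carrier_iff_mk_eq, ConjClasses.mk_eq_mk_iff_isConj]
    constructor
    · rintro ⟨h, hh, rfl⟩
      let k : H := ⟨h, hh⟩
      exact ⟨k * y * k⁻¹, (isConj_iff.2 ⟨k, rfl⟩).symm, rfl⟩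
    · rintro ⟨v, hv, rfl⟩
      obtain ⟨h, rfl⟩ := isConj_iff.1 hv.symm
      exact ⟨h, h.2, rfl⟩
  rw [this, Set.ncard_image_of_injective _ Subtype.val_injective, Nat.card_coe_set_eq]

theorem ncard_conjOrbit_top (y : G) :
    (conjOrbit ⊤ y).ncard = Nat.card (ConjClasses.mk y).carrier := by
  rw [Nat.card_coe_set_eq]
  congr 1
  ext u
  rw [ConjClasses.mem_carrier_iff_mk_eq, ConjClasses.mk_eq_mk_iff_isConj, isConj_comm, isConj_iff]
  simp [conjOrbit]

theorem ncard_conjOrbit_conj [H.Normal] (g y : G) :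
    (conjOrbit H (g * y * g⁻¹)).ncard = (conjOrbit H y).ncard := by
  rw [← Set.ncard_image_of_injective (conjOrbit H y) (MulAut.conj g).injective]
  congr 1
  ext u
  rw [← conj_mem_conjOrbit_conj_iff g⁻¹]
  constructor
  · intro h
    exact ⟨g⁻¹ * u * g⁻¹⁻¹, by convert h using 1; group, by simp [mul_assoc]⟩
  · rintro ⟨v, hv, rfl⟩
    convert hv using 1 <;> simp [mul_assoc]

/-- The indicator function of the orbit of `y` under conjugation by the subgroup `H`. -/
noncomputable def orbitIndicator (H : Subgroup G) (y : G) : G → ℕ :=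
  (conjOrbit H y).indicator 1

/-- The convolution of two functions on a finite group. -/
def convolution [Fintype G] {R : Type*} [Semiring R] (a b : G → R) (w : G) : R :=
  ∑ u, a u * b (u⁻¹ * w)

theorem sum_convolution_mul [Fintype G] {R : Type*} [CommSemiring R] (a b c : G → R) :
    ∑ w, convolution a b w * c w = ∑ u, ∑ v, a u * b v * c (u * v) := by
  simp only [convolution, Finset.sum_mul]
  rw [Finset.sum_comm]
  refine Finset.sum_congr rfl fun u _ => ?_
  rw [← Equiv.sum_comp (Equiv.mulLeft u)]
  simp

theorem sum_convolution [Fintype G] {R : Type*} [CommSemiring R] (a b : G → R) :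
    ∑ w, convolution a b w = (∑ u, a u) * ∑ v, b v := by
  simpa [Finset.sum_mul_sum] using sum_convolution_mul a b 1

theorem orbitIndicator_conj [H.Normal] {h : G} (hh : h ∈ H) (y u : G) :
    orbitIndicator H y (h * u * h⁻¹) = orbitIndicator H y u := by
  classical
  simp only [orbitIndicator, Set.indicator_apply, Pi.one_apply, conj_mem_conjOrbit_iff hh]

theorem orbitIndicator_conj_conj [H.Normal] (g y u : G) :
    orbitIndicator H (g * y * g⁻¹) (g * u * g⁻¹) = orbitIndicator H y u := by
  classical
  simp only [orbitIndicator, Set.indicator_apply, Pi.one_apply, conj_mem_conjOrbit_conj_iff]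

theorem orbitIndicator_conj_eq {h : G} (hh : h ∈ H) (y : G) :
    orbitIndicator H (h * y * h⁻¹) = orbitIndicator H y := by
  simp [orbitIndicator, conjOrbit_conj_eq hh]

theorem sum_orbitIndicator [Fintype G] (y : G) :
    ∑ u, orbitIndicator H y u = (conjOrbit H y).ncard := by
  classical
  simp [orbitIndicator, Set.indicator_apply, Set.ncard_eq_toFinset_card']

theorem sum_orbitIndicator_mul [Fintype G] {R : Type*} [Semiring R] (y : G) (χ : G → R)
    (hχ : ∀ g x, χ (g * x * g⁻¹) = χ x) :
    ∑ u, (orbitIndicator H y u : R) * χ u = (conjOrbit H y).ncard * χ y := by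
  rw [← sum_orbitIndicator, Nat.cast_sum, Finset.sum_mul]
  refine Finset.sum_congr rfl fun u _ => ?_
  by_cases hu : u ∈ conjOrbit H y
  · obtain ⟨h, -, rfl⟩ := hu
    rw [hχ]
  · simp [orbitIndicator, hu]

/-- Conjugation by an element outside `H` swaps the orbits of `y` and `gyg⁻¹`. The two indicators
commute under convolution, since one is supported in `H` and the other is invariant under `H`. -/
theorem convolution_orbitIndicator_conj [Fintype G] [hH : H.Normal] (hH2 : H.index = 2) {y g : G}
    (hy : y ∈ H) (hg : g ∉ H) (k w : G) :
    convolution (orbitIndicator H y) (orbitIndicator H (g * y * g⁻¹)) (k * w * k⁻¹) =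
      convolution (orbitIndicator H y) (orbitIndicator H (g * y * g⁻¹)) w := by
  set y' := g * y * g⁻¹ with hy'
  have hconj : ∀ a b k w, convolution (orbitIndicator H (k * a * k⁻¹))
      (orbitIndicator H (k * b * k⁻¹)) (k * w * k⁻¹) =
      convolution (orbitIndicator H a) (orbitIndicator H b) w := by
    intro a b k w
    unfold convolution
    rw [← (MulAut.conj k).toEquiv.sum_comp]
    refine Finset.sum_congr rfl fun u _ => ?_
    simp only [MulEquiv.toEquiv_eq_coe, EquivLike.coe_coe, MulAut.conj_apply]
    rw [orbitIndicator_conj_conj, ← orbitIndicator_conj_conj k b]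
    congr 2
    group
  have hcomm : ∀ w, convolution (orbitIndicator H y') (orbitIndicator H y) w =
      convolution (orbitIndicator H y) (orbitIndicator H y') w := by
    intro w
    unfold convolution
    rw [← Equiv.sum_comp ((Equiv.inv G).trans (Equiv.mulRight w))]
    refine Finset.sum_congr rfl fun u _ => ?_
    simp only [Equiv.trans_apply, Equiv.inv_apply, Equiv.coe_mulRight]
    by_cases hu : u⁻¹ * w ∈ conjOrbit H y'
    · rw [mul_comm, ← orbitIndicator_conj
        ((mem_iff_mem_of_mem_conjOrbit hu).2 (hH.conj_mem y hy g)) y]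
      congr 2
      group
    · simp [orbitIndicator, hu]
  by_cases hk : k ∈ H
  · have := hconj y y' k w
    rwa [orbitIndicator_conj_eq hk, orbitIndicator_conj_eq hk] at this
  · have hkg : k * g ∈ H := by rw [Subgroup.mul_mem_iff_of_index_two hH2]; tauto
    have hkg' : k * g⁻¹ ∈ H := by rw [Subgroup.mul_mem_iff_of_index_two hH2, inv_mem_iff]; tauto
    have := hconj y y' k w
    rw [show k * y' * k⁻¹ = (k * g) * y * (k * g)⁻¹ by rw [hy']; group,
      show k * y * k⁻¹ = (k * g⁻¹) * y' * (k * g⁻¹)⁻¹ by rw [hy']; group,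
      orbitIndicator_conj_eq hkg, orbitIndicator_conj_eq hkg', hcomm] at this
    exact this

end

/-! ### Orbit sums acting as scalars -/

section

variable {G V : Type*} [Group G] [AddCommGroup V] [Module ℂ V] [Fintype G]
  {ρ : Representation ℂ G V} {H : Subgroup G}

theorem trace_sum_smul (a : G → ℂ) :
    LinearMap.trace ℂ V (∑ w, a w • ρ w) = ∑ w, a w * ρ.character w := by
  simp [Representation.character]

/-- Schur's lemma for the restriction to `H`; the support of `a` need not lie in `H`. -/
theorem exists_sum_smul_eq_smul_one [FiniteDimensional ℂ V]
    (hρ : Representation.IsIrreducible (ρ.comp H.subtype : Representation ℂ H V)) {a : G → ℂ}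
    (ha : ∀ h ∈ H, ∀ w, a (h * w * h⁻¹) = a w) : ∃ c : ℂ, ∑ w, a w • ρ w = c • 1 := by
  refine exists_eq_smul_one_of_commute hρ _ fun h => ?_
  change (∑ w, a w • ρ w) * ρ h = ρ h * ∑ w, a w • ρ w
  conv_lhs => rw [← (MulAut.conj (h : G)).toEquiv.sum_comp]
  rw [Finset.sum_mul, Finset.mul_sum]
  refine Finset.sum_congr rfl fun w _ => ?_
  simp only [MulEquiv.toEquiv_eq_coe, EquivLike.coe_coe, MulAut.conj_apply]
  rw [ha h h.2, smul_mul_assoc, mul_smul_comm, ← map_mul, ← map_mul, inv_mul_cancel_right]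

theorem sum_mul_character_mul_sum_mul_character [FiniteDimensional ℂ V]
    (hρ : Representation.IsIrreducible (ρ.comp H.subtype : Representation ℂ H V)) {a b : G → ℂ}
    (ha : ∀ h ∈ H, ∀ w, a (h * w * h⁻¹) = a w) (hb : ∀ h ∈ H, ∀ w, b (h * w * h⁻¹) = b w) :
    (∑ w, a w * ρ.character w) * ∑ w, b w * ρ.character w =
      finrank ℂ V * ∑ w, convolution a b w * ρ.character w := by
  obtain ⟨c, hc⟩ := exists_sum_smul_eq_smul_one hρ ha
  obtain ⟨e, he⟩ := exists_sum_smul_eq_smul_one hρ hb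
  have hce : ∑ w, convolution a b w • ρ w = (c * e) • 1 := by
    calc ∑ w, convolution a b w • ρ w = ∑ u, ∑ v, (a u * b v) • ρ (u * v) := by
          simp only [convolution, Finset.sum_smul]
          rw [Finset.sum_comm]
          refine Finset.sum_congr rfl fun u _ => ?_
          rw [← Equiv.sum_comp (Equiv.mulLeft u)]
          simp
      _ = (∑ u, a u • ρ u) * ∑ v, b v • ρ v := by
          simp only [Finset.sum_mul_sum, smul_mul_smul_comm, map_mul]
      _ = (c * e) • 1 := by rw [hc, he, smul_mul_smul_comm, one_mul]
  simp only [← trace_sum_smul, hc, he, hce, map_smul, LinearMap.trace_one, smul_eq_mul]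
  ring

/-- The scalar is the image of an element of `ℤ[G]`, which is a finite `ℤ`-module. -/
theorem isIntegral_class_sum [FiniteDimensional ℂ V]
    (hρ : Representation.IsIrreducible (ρ.comp H.subtype : Representation ℂ H V)) {a : G → ℕ}
    (ha : ∀ h ∈ H, ∀ w, a (h * w * h⁻¹) = a w) :
    IsIntegral ℤ ((∑ w, (a w : ℂ) * ρ.character w) / finrank ℂ V) := by
  obtain ⟨c, hc⟩ := exists_sum_smul_eq_smul_one hρ (a := fun w => (a w : ℂ))
    fun h hh w => by rw [ha h hh]
  rcases Nat.eq_zero_or_pos (finrank ℂ V) with h0 | h0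
  · simp [h0, isIntegral_zero]
  have : Nontrivial V := nontrivial_of_finrank_pos (R := ℂ) h0
  have hz : IsIntegral ℤ (∑ w, a w • MonoidAlgebra.of ℤ G w) := IsIntegral.of_finite ℤ _
  have hz' := hz.map (MonoidAlgebra.lift ℤ (End ℂ V) G ρ)
  have hc' : algebraMap ℂ (End ℂ V) c =
      MonoidAlgebra.lift ℤ (End ℂ V) G ρ (∑ w, a w • MonoidAlgebra.of ℤ G w) := by
    rw [Algebra.algebraMap_eq_smul_one, ← hc]
    simp [Nat.cast_smul_eq_nsmul]
  rw [← hc', isIntegral_algebraMap_iff (FaithfulSMul.algebraMap_injective ℂ (End ℂ V))] at hz'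
  rw [← trace_sum_smul (ρ := ρ), hc, map_smul, LinearMap.trace_one, smul_eq_mul,
    mul_div_cancel_right₀ _ (by exact_mod_cast h0.ne')]
  exact hz'

end

/-! ### Congruences modulo a prime containing 2 -/

section

variable {M : Ideal (integralClosure ℤ ℂ)} {a b c : ℂ}

theorem CongrMod.isIntegral_sub (h : CongrMod M a b) : IsIntegral ℤ (a - b) := by
  obtain ⟨r, -, h⟩ := h
  exact h ▸ r.2

theorem CongrMod.isIntegral (h : CongrMod M a b) (hb : IsIntegral ℤ b) : IsIntegral ℤ a := by
  simpa using h.isIntegral_sub.add hb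

theorem congrMod_iff_sub : CongrMod M a b ↔ CongrMod M (a - b) 0 := by
  simp [CongrMod]

theorem CongrMod.refl (M : Ideal (integralClosure ℤ ℂ)) (a : ℂ) : CongrMod M a a :=
  ⟨0, M.zero_mem, by simp⟩

theorem CongrMod.symm (h : CongrMod M a b) : CongrMod M b a := by
  obtain ⟨r, hr, h⟩ := h
  exact ⟨-r, M.neg_mem hr, by simp [← h]⟩

theorem CongrMod.trans (h : CongrMod M a b) (h' : CongrMod M b c) : CongrMod M a c := by
  obtain ⟨r, hr, h⟩ := h
  obtain ⟨s, hs, h'⟩ := h'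
  exact ⟨r + s, M.add_mem hr hs, by simp [← h, ← h']⟩

theorem CongrMod.add {a' b' : ℂ} (h : CongrMod M a b) (h' : CongrMod M a' b') :
    CongrMod M (a + a') (b + b') := by
  obtain ⟨r, hr, h⟩ := h
  obtain ⟨s, hs, h'⟩ := h'
  exact ⟨r + s, M.add_mem hr hs, by simp only [Subalgebra.coe_add, ← h, ← h']; ring⟩

theorem CongrMod.sum {ι : Type*} (s : Finset ι) {f g : ι → ℂ}
    (h : ∀ i ∈ s, CongrMod M (f i) (g i)) : CongrMod M (∑ i ∈ s, f i) (∑ i ∈ s, g i) := by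
  classical
  induction s using Finset.induction_on with
  | empty => exact CongrMod.refl M _
  | insert i s hi ih =>
    rw [Finset.sum_insert hi, Finset.sum_insert hi]
    exact (h i (by simp)).add (ih fun j hj => h j (by simp [hj]))

theorem CongrMod.mul_left (hc : IsIntegral ℤ c) (h : CongrMod M a b) :
    CongrMod M (c * a) (c * b) := by
  obtain ⟨r, hr, h⟩ := h
  exact ⟨⟨c, hc⟩ * r, M.mul_mem_left _ hr, by simp [← h, mul_sub]⟩

theorem isIntegral_natCast (n : ℕ) : IsIntegral ℤ (n : ℂ) := by
  simpa using isIntegral_algebraMap (R := ℤ) (A := ℂ) (x := (n : ℤ))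

theorem congrMod_mul_self_of_two_mem (h2 : 2 ∈ M) (hc : IsIntegral ℤ c) :
    CongrMod M (2 * c) 0 :=
  ⟨2 * ⟨c, hc⟩, M.mul_mem_right _ h2, by rw [sub_zero]; rfl⟩

theorem CongrMod.of_mul_left (hM : M.IsPrime) (ha : IsIntegral ℤ a) (hb : IsIntegral ℤ b)
    (h : CongrMod M (a * b) 0) : CongrMod M a 0 ∨ CongrMod M b 0 := by
  obtain ⟨r, hr, h⟩ := h
  have : (⟨a, ha⟩ * ⟨b, hb⟩ : integralClosure ℤ ℂ) = r := Subtype.ext (by simpa using h)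
  rw [← this] at hr
  rcases hM.mem_or_mem hr with h | h
  · exact Or.inl ⟨_, h, by simp⟩
  · exact Or.inr ⟨_, h, by simp⟩

theorem congrMod_natCast_of_odd (h2 : 2 ∈ M) {n : ℕ} (hn : Odd n) : CongrMod M n 1 := by
  obtain ⟨k, rfl⟩ := hn
  have := (congrMod_mul_self_of_two_mem h2 (isIntegral_natCast k)).add (CongrMod.refl M 1)
  simpa using this

theorem not_congrMod_one_zero (hM : M.IsPrime) : ¬ CongrMod M 1 0 := by
  rintro ⟨r, hr, h⟩
  have : r = 1 := Subtype.ext (by simpa using h.symm)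
  exact hM.ne_top ((Ideal.eq_top_iff_one M).2 (this ▸ hr))

theorem not_congrMod_natCast_zero_of_odd (hM : M.IsPrime) (h2 : 2 ∈ M) {n : ℕ} (hn : Odd n) :
    ¬ CongrMod M n 0 := fun h =>
  not_congrMod_one_zero hM ((congrMod_natCast_of_odd h2 hn).symm.trans h)

theorem CongrMod.of_odd_mul_left (hM : M.IsPrime) (h2 : 2 ∈ M) {n : ℕ} (hn : Odd n)
    (hab : IsIntegral ℤ (a - b)) (h : CongrMod M (n * a) (n * b)) : CongrMod M a b := by
  rw [congrMod_iff_sub, ← mul_sub] at h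
  rw [congrMod_iff_sub]
  exact (h.of_mul_left hM (isIntegral_natCast n) hab).resolve_left
    (not_congrMod_natCast_zero_of_odd hM h2 hn)

/-- Modulo 2, `(a - b) ^ 2` agrees with `a ^ 2 - b ^ 2`, and `M` is prime. -/
theorem CongrMod.of_sq (hM : M.IsPrime) (h2 : 2 ∈ M) (hb : IsIntegral ℤ b)
    (h : CongrMod M (a ^ 2) (b ^ 2)) : CongrMod M a b := by
  have ha : IsIntegral ℤ a := (h.isIntegral (hb.pow 2)).of_pow two_pos
  have hab := ha.sub hb
  have h' : CongrMod M ((a - b) * (a - b)) 0 := by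
    have := (congrMod_iff_sub.1 h).add
      (congrMod_mul_self_of_two_mem h2 ((hb.mul hab).neg))
    convert this using 1 <;> ring
  rw [congrMod_iff_sub]
  exact (h'.of_mul_left hM hab hab).elim id id

end

/-! ### Character values as sums of roots of unity -/

theorem exists_sum_sq_sub_sum_sq_eq_two_mul {ι : Type*} (s : Finset ι) (μ : ι → ℂ)
    (hμ : ∀ i ∈ s, IsIntegral ℤ (μ i)) :
    ∃ e : ℂ, IsIntegral ℤ e ∧ (∑ i ∈ s, μ i) ^ 2 - ∑ i ∈ s, μ i ^ 2 = 2 * e := by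
  classical
  induction s using Finset.induction_on with
  | empty => exact ⟨0, isIntegral_zero, by simp⟩
  | insert i s hi ih =>
    obtain ⟨e, he, h⟩ := ih fun j hj => hμ j (by simp [hj])
    refine ⟨e + μ i * ∑ j ∈ s, μ j, he.add ((hμ i (by simp)).mul
      (IsIntegral.sum _ fun j hj => hμ j (by simp [hj]))), ?_⟩
    rw [Finset.sum_insert hi, Finset.sum_insert hi]
    linear_combination h

section

variable {G V : Type*} [Group G] [AddCommGroup V] [Module ℂ V] [FiniteDimensional ℂ V]
  (ρ : Representation ℂ G V)

theorem exists_character_pow_eq_sum {x : G} {m : ℕ} (hm : m ≠ 0) (hx : x ^ m = 1) :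
    ∃ μ : Fin (finrank ℂ V) → ℂ, (∀ i, μ i ^ m = 1) ∧
      ∀ j : ℕ, ρ.character (x ^ j) = ∑ i, μ i ^ j := by
  obtain ⟨μ, h, h'⟩ := exists_eigenvalues_of_pow_eq_one (A := ρ x) hm
    (by rw [← map_pow, hx, map_one])
  exact ⟨μ, h, fun j => by rw [← h', ← map_pow]; rfl⟩

theorem isIntegral_character [Finite G] (x : G) : IsIntegral ℤ (ρ.character x) := by
  obtain ⟨μ, h, h'⟩ := exists_character_pow_eq_sum ρ (orderOf_pos x).ne' (pow_orderOf_eq_one x)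
  have := h' 1
  rw [pow_one] at this
  rw [this]
  exact IsIntegral.sum _ fun i _ => ((h i ▸ isIntegral_one : IsIntegral ℤ _).of_pow
    (orderOf_pos x)).pow 1

theorem congrMod_character_sq [Finite G] {M : Ideal (integralClosure ℤ ℂ)} (h2 : 2 ∈ M) (x : G) :
    CongrMod M (ρ.character x ^ 2) (ρ.character (x ^ 2)) := by
  obtain ⟨μ, h, h'⟩ := exists_character_pow_eq_sum ρ (orderOf_pos x).ne' (pow_orderOf_eq_one x)
  obtain ⟨e, he, hse⟩ := exists_sum_sq_sub_sum_sq_eq_two_mul Finset.univ μ fun i _ =>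
    (h i ▸ isIntegral_one : IsIntegral ℤ _).of_pow (orderOf_pos x)
  have := h' 1
  simp only [pow_one] at this
  rw [congrMod_iff_sub, this, h' 2, hse]
  exact congrMod_mul_self_of_two_mem h2 he

/-- Squaring repeatedly carries a congruence `χ x ≡ 0` to `χ 1 ≡ 0`, impossible for odd degree. -/
theorem character_ne_zero_of_pow_eq_one [Finite G] {M : Ideal (integralClosure ℤ ℂ)} (hM : M.IsPrime)
    (h2 : 2 ∈ M) (hV : Odd (finrank ℂ V)) {x : G} {k : ℕ} (hx : x ^ 2 ^ k = 1) :
    ρ.character x ≠ 0 := by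
  have key : ∀ k (x : G), x ^ 2 ^ k = 1 → ¬ CongrMod M (ρ.character x) 0 := by
    intro k
    induction k with
    | zero =>
      intro x hx h
      rw [pow_zero, pow_one] at hx
      rw [hx, Representation.char_one] at h
      exact not_congrMod_natCast_zero_of_odd hM h2 hV h
    | succ k ih =>
      intro x hx h
      refine ih (x ^ 2) (by rw [← pow_mul, ← pow_succ', hx]) ?_
      have := h.mul_left (isIntegral_character ρ x)
      rw [mul_zero, ← pow_two] at this
      exact (congrMod_character_sq ρ h2 x).symm.trans this
  exact fun h => key k x hx (h ▸ CongrMod.refl M _)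

end

/-! ### The fixed field of `σ` -/

/-- The subfield of `ℂ` consisting of the elements of `ℚ^ab` that are fixed by `σ`. -/
noncomputable def sigmaFixedField : Subfield ℂ :=
  (RingHom.eqLocusField (sigma : Qab →+* Qab) (RingHom.id Qab)).map (algebraMap Qab ℂ)

theorem mem_sigmaFixedField {z : ℂ} :
    z ∈ sigmaFixedField ↔ ∃ q : Qab, (q : ℂ) = z ∧ sigma q = q := by
  rw [sigmaFixedField, Subfield.mem_map]
  exact ⟨fun ⟨q, h, h'⟩ => ⟨q, h', h⟩, fun ⟨q, h', h⟩ => ⟨q, h, h'⟩⟩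

theorem sigmaFixed_iff {G : Type*} [Group G] {χ : G → ℂ} :
    SigmaFixed χ ↔ ∀ g, χ g ∈ sigmaFixedField := by
  simp only [mem_sigmaFixedField, SigmaFixed]

theorem mem_sigmaFixedField_of_pow_eq_one {z : ℂ} {k : ℕ} (hz : z ^ 2 ^ k = 1) :
    z ∈ sigmaFixedField := by
  refine mem_sigmaFixedField.2 ⟨⟨z, mem_Qab_of_pow_eq_one (by positivity) hz⟩, rfl, ?_⟩
  exact isSigma_sigma.1 _ k (Subtype.ext hz)

/-! ### Block congruences for class functions -/

theorem sum_eq_sum_conjClasses {G : Type*} [Group G] [Fintype G] [Fintype (ConjClasses G)]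
    {F : G → ℂ} (hF : ∀ g x, F (g * x * g⁻¹) = F x) :
    ∑ w, F w = ∑ K : ConjClasses G, (Nat.card K.carrier : ℂ) * F (Quotient.out K) := by
  classical
  rw [← Finset.sum_fiberwise Finset.univ (ConjClasses.mk : G → ConjClasses G)]
  refine Finset.sum_congr rfl fun K _ => ?_
  have hK : ConjClasses.mk (Quotient.out K) = K := Quotient.out_eq K
  have hcard : Nat.card K.carrier = (Finset.univ.filter fun w : G => ConjClasses.mk w = K).card := by
    rw [← Nat.card_eq_finsetCard]
    refine Nat.card_congr (Equiv.subtypeEquivRight fun w => ?_)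
    simp [ConjClasses.mem_carrier_iff_mk_eq]
  rw [hcard, ← nsmul_eq_mul]
  refine Finset.sum_eq_card_nsmul fun w hw => ?_
  have hw' : ConjClasses.mk (Quotient.out K) = ConjClasses.mk w := by
    rw [hK, (Finset.mem_filter.1 hw).2]
  obtain ⟨g, hg⟩ := isConj_iff.1 (ConjClasses.mk_eq_mk_iff_isConj.1 hw')
  rw [← hg, hF]

theorem centralCharacter_one {G : Type*} [Group G] (x : G) :
    centralCharacter (fun _ => 1) x = Nat.card (ConjClasses.mk x).carrier := by
  simp [centralCharacter]

theorem SameBlock.congrMod_sum {G : Type*} [Group G] [Fintype G]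
    {M : Ideal (integralClosure ℤ ℂ)} {χ : G → ℂ} (hB : SameBlock M χ fun _ => 1)
    (hχ : ∀ g x, χ (g * x * g⁻¹) = χ x) {c : G → ℕ} (hc : ∀ g x, c (g * x * g⁻¹) = c x) :
    CongrMod M ((∑ w, (c w : ℂ) * χ w) / χ 1) (∑ w, c w : ℕ) := by
  have := Fintype.ofFinite (ConjClasses G)
  rw [Nat.cast_sum, sum_eq_sum_conjClasses (F := fun w => (c w : ℂ) * χ w) (fun g x => by rw [hχ, hc]),
    sum_eq_sum_conjClasses (F := fun w => (c w : ℂ)) (fun g x => by rw [hc]), Finset.sum_div]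
  refine CongrMod.sum _ fun K _ => ?_
  have hK : ConjClasses.mk (Quotient.out K) = K := Quotient.out_eq K
  have := (hB (Quotient.out K)).mul_left (isIntegral_natCast (c (Quotient.out K)))
  rw [centralCharacter_one, centralCharacter, hK] at this
  convert this using 1 <;> ring

/-! ### The index two step -/

section

variable {G V : Type*} [Group G] [Finite G] [AddCommGroup V] [Module ℂ V] [FiniteDimensional ℂ V]
  {ρ : Representation ℂ G V} {H : Subgroup G} {M : Ideal (integralClosure ℤ ℂ)}

theorem sameBlock_one_res_of_sameBlock_one [H.Normal] (hV : finrank ℂ V ≠ 0)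
    (hρ : Representation.IsIrreducible (ρ.comp H.subtype : Representation ℂ H V))
    (hH : H.index = 2) (hM : M.IsPrime) (h2 : 2 ∈ M)
    (hB : SameBlock M ρ.character fun _ => 1) :
    SameBlock M (Res H ρ.character) fun _ => 1 := by
  have := Fintype.ofFinite G
  intro y
  obtain ⟨g, hg⟩ : ∃ g, g ∉ H := by
    by_contra! h
    rw [(Subgroup.eq_top_iff' H).2 h, Subgroup.index_top] at hH
    omega
  have hχ : ∀ g x, ρ.character (g * x * g⁻¹) = ρ.character x := fun g x => ρ.char_conj x g
  have hV' : (finrank ℂ V : ℂ) ≠ 0 := by exact_mod_cast hV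
  let a := orbitIndicator H (y : G)
  let b := orbitIndicator H (g * y * g⁻¹)
  have hab := sum_mul_character_mul_sum_mul_character hρ
    (a := fun w => (a w : ℂ)) (b := fun w => (b w : ℂ))
    (fun h hh w => congrArg Nat.cast (orbitIndicator_conj hh _ w))
    (fun h hh w => congrArg Nat.cast (orbitIndicator_conj hh _ w))
  have hsum := hB.congrMod_sum hχ (c := convolution a b)
    fun k w => convolution_orbitIndicator_conj hH y.2 hg k w
  have hcast : ∀ w, convolution (fun w => (a w : ℂ)) (fun w => (b w : ℂ)) w =
      (convolution a b w : ℕ) := fun w => by simp [convolution]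
  simp only [hcast] at hab
  rw [sum_orbitIndicator_mul _ _ hχ, sum_orbitIndicator_mul _ _ hχ, ncard_conjOrbit_conj, hχ] at hab
  rw [sum_convolution, sum_orbitIndicator, sum_orbitIndicator, ncard_conjOrbit_conj,
    Representation.char_one] at hsum
  rw [ncard_conjOrbit] at hab hsum
  rw [centralCharacter_one, centralCharacter]
  -- By invariance of `χ`, the orbits of `y` and `gyg⁻¹` contribute equal factors, so `hsum`
  -- compares two squares.
  refine CongrMod.of_sq hM h2 (isIntegral_natCast _) ?_
  convert hsum using 1
  · rw [eq_div_iff hV']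
    simp only [Res, Subgroup.coe_one, Representation.char_one]
    field_simp
    linear_combination hab
  · push_cast
    ring

theorem sameBlock_one_of_sameBlock_one_res [H.Normal] (hV : Odd (finrank ℂ V))
    (hρ : Representation.IsIrreducible (ρ.comp H.subtype : Representation ℂ H V))
    (hH : H.index = 2) (hM : M.IsPrime) (h2 : 2 ∈ M)
    (hB : SameBlock M (Res H ρ.character) fun _ => 1) :
    SameBlock M ρ.character fun _ => 1 := by
  have := Fintype.ofFinite G
  intro x
  have hV' : (finrank ℂ V : ℂ) ≠ 0 := by exact_mod_cast hV.pos.ne'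
  have hχ : ∀ g x, ρ.character (g * x * g⁻¹) = ρ.character x := fun g x => ρ.char_conj x g
  by_cases hx : x ∈ H
  · obtain ⟨r, hr⟩ := natCard_carrier_subgroup_dvd H ⟨x, hx⟩
    have := (hB ⟨x, hx⟩).mul_left (isIntegral_natCast r)
    simp only [centralCharacter, Res, Subgroup.coe_one] at this ⊢
    rw [hr]
    push_cast
    convert this using 1 <;> ring
  have hd := congrMod_natCast_of_odd h2 hV
  have hint : IsIntegral ℤ (centralCharacter ρ.character x) := by
    have h := isIntegral_class_sum hρ (a := orbitIndicator ⊤ x)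
      fun h _ w => orbitIndicator_conj (Subgroup.mem_top h) x w
    rwa [sum_orbitIndicator_mul _ _ hχ, ← Representation.char_one ρ, ncard_conjOrbit_top] at h
  have hdω : finrank ℂ V * centralCharacter ρ.character x =
      Nat.card (ConjClasses.mk x).carrier * ρ.character x := by
    rw [centralCharacter, Representation.char_one]
    field_simp
  rw [centralCharacter_one]
  -- The odd degree is invertible modulo `M`, so the denominator of `ω` can be cleared.
  refine CongrMod.of_odd_mul_left hM h2 hV (hint.sub (isIntegral_natCast _)) ?_
  rw [hdω, mul_comm (finrank ℂ V : ℂ)]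
  rcases Nat.even_or_odd (Nat.card (ConjClasses.mk x).carrier) with hK | hK
  · obtain ⟨m, hm⟩ := hK
    rw [← two_mul] at hm
    rw [hm]
    push_cast
    rw [mul_assoc, mul_assoc]
    exact (congrMod_mul_self_of_two_mem h2
      ((isIntegral_natCast m).mul (isIntegral_character ρ x))).trans
      (congrMod_mul_self_of_two_mem h2
        ((isIntegral_natCast m).mul (isIntegral_natCast _))).symm
  refine CongrMod.mul_left (isIntegral_natCast _) ?_
  have hx2 : x ^ 2 ∈ H := Subgroup.sq_mem_of_index_two hH x
  have hL : Odd (Nat.card (ConjClasses.mk (⟨x ^ 2, hx2⟩ : H)).carrier) :=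
    Odd.of_dvd_nat hK ((natCard_carrier_subgroup_dvd H ⟨x ^ 2, hx2⟩).trans
      (natCard_carrier_pow_dvd x 2))
  have hsq : CongrMod M (ρ.character (x ^ 2)) (finrank ℂ V) := by
    have h := (hB ⟨x ^ 2, hx2⟩).mul_left (isIntegral_natCast (finrank ℂ V))
    rw [centralCharacter_one, centralCharacter, Res, Res, Subgroup.coe_one,
      Representation.char_one, mul_div_cancel₀ _ hV', mul_comm (finrank ℂ V : ℂ)] at h
    exact h.of_odd_mul_left hM h2 hL ((isIntegral_character ρ _).sub (isIntegral_natCast _))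
  refine CongrMod.of_sq hM h2 (isIntegral_natCast _) ?_
  refine ((congrMod_character_sq ρ h2 x).trans hsq).trans (hd.trans ?_)
  rw [← Nat.cast_pow]
  exact (congrMod_natCast_of_odd h2 hV.pow).symm

theorem sigmaFixed_of_sigmaFixed_res [H.Normal] (hV : Odd (finrank ℂ V))
    (hρ : Representation.IsIrreducible (ρ.comp H.subtype : Representation ℂ H V))
    (hH : H.index = 2) (hM : M.IsPrime) (h2 : 2 ∈ M)
    (hσ : SigmaFixed (Res H ρ.character)) : SigmaFixed ρ.character := by
  have := Fintype.ofFinite G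
  rw [sigmaFixed_iff] at hσ ⊢
  replace hσ : ∀ h ∈ H, ρ.character h ∈ sigmaFixedField := fun h hh => hσ ⟨h, hh⟩
  intro x
  have hV' : (finrank ℂ V : ℂ) ≠ 0 := by exact_mod_cast hV.pos.ne'
  have hχ : ∀ g x, ρ.character (g * x * g⁻¹) = ρ.character x := fun g x => ρ.char_conj x g
  by_cases hx : x ∈ H
  · exact hσ x hx
  obtain ⟨k, m, hm, hkm⟩ := Nat.exists_eq_two_pow_mul_odd (orderOf_pos x).ne'
  -- `m` is the odd part of the order of `x`; as even powers of `x` lie in `H`, `y` and `x` lie in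
  -- the same coset.
  set y := x ^ m
  have hy : y ∉ H := by
    obtain ⟨j, rfl⟩ := hm
    intro hy
    refine hx ((H.mul_mem_cancel_left (x := x ^ (2 * j)) ?_).1 (by rwa [← pow_succ]))
    rw [pow_mul]
    exact H.pow_mem (Subgroup.sq_mem_of_index_two hH x) j
  have hyk : y ^ 2 ^ k = 1 := by rw [← pow_mul, mul_comm, ← hkm, pow_orderOf_eq_one]
  have hy0 := character_ne_zero_of_pow_eq_one ρ hM h2 hV hyk
  have hyσ : ρ.character y ∈ sigmaFixedField := by
    obtain ⟨μ, h, h'⟩ := exists_character_pow_eq_sum ρ (by positivity) hyk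
    have := h' 1
    simp only [pow_one] at this
    rw [this]
    exact sum_mem fun i _ => mem_sigmaFixedField_of_pow_eq_one (h i)
  have hab := sum_mul_character_mul_sum_mul_character hρ
    (a := fun w => (orbitIndicator H x w : ℂ)) (b := fun w => (orbitIndicator H y w : ℂ))
    (fun h hh w => by rw [orbitIndicator_conj hh]) (fun h hh w => by rw [orbitIndicator_conj hh])
  have hpos : ∀ z : G, ((conjOrbit H z).ncard : ℂ) ≠ 0 := fun z => by
    exact_mod_cast ((Set.ncard_pos (Set.toFinite _)).2 ⟨z, self_mem_conjOrbit H z⟩).ne'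
  rw [sum_orbitIndicator_mul _ _ hχ, sum_orbitIndicator_mul _ _ hχ, sum_convolution_mul] at hab
  have hmem : (finrank ℂ V : ℂ) * ∑ u, ∑ v, (orbitIndicator H x u : ℂ) * (orbitIndicator H y v : ℂ) *
      ρ.character (u * v) ∈ sigmaFixedField := by
    refine mul_mem (natCast_mem _ _) (sum_mem fun u _ => sum_mem fun v _ => ?_)
    by_cases hu : u ∈ conjOrbit H x
    · by_cases hv : v ∈ conjOrbit H y
      · refine mul_mem (mul_mem (natCast_mem _ _) (natCast_mem _ _)) (hσ _ ?_)
        rw [Subgroup.mul_mem_iff_of_index_two hH, mem_iff_mem_of_mem_conjOrbit hu,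
          mem_iff_mem_of_mem_conjOrbit hv]
        tauto
      · simp [orbitIndicator, hv]
    · simp [orbitIndicator, hu]
  rw [← hab] at hmem
  -- The orbit sizes and `χ y` are nonzero, so `χ x` is recovered by division in the fixed field.
  have hx' : ρ.character x = (((conjOrbit H x).ncard : ℂ) * ρ.character x *
      (((conjOrbit H y).ncard : ℂ) * ρ.character y)) /
      (((conjOrbit H x).ncard : ℂ) * (((conjOrbit H y).ncard : ℂ) * ρ.character y)) := by
    have := hpos x
    have := hpos y
    field_simp
  rw [hx']
  exact div_mem hmem (mul_mem (natCast_mem _ _) (mul_mem (natCast_mem _ _) hyσ))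

end

/-! ### Induction on the index -/

/-- Pulling back along `f` preserves irreducible characters of odd degree, and both preserves and
reflects membership in the principal `2`-block and `σ`-fixedness of such characters. -/
def OddRestrictionProperty (M : Ideal (integralClosure ℤ ℂ)) {A B : Type*} [Group A] [Group B]
    (f : A →* B) : Prop :=
  ∀ χ ∈ IrrOdd B, χ ∘ f ∈ IrrOdd A ∧ (χ ∈ IrrB0 M B ↔ χ ∘ f ∈ IrrB0 M A) ∧
    (SigmaFixed χ ↔ SigmaFixed (χ ∘ f))

section

variable {M : Ideal (integralClosure ℤ ℂ)}

theorem OddRestrictionProperty.comp {A B C : Type*} [Group A] [Group B] [Group C] {g : B →* C}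
    {f : A →* B} (hg : OddRestrictionProperty M g) (hf : OddRestrictionProperty M f) :
    OddRestrictionProperty M (g.comp f) := fun χ hχ =>
  have h1 := hg χ hχ
  have h2 := hf _ h1.1
  ⟨h2.1, h1.2.1.trans h2.2.1, h1.2.2.trans h2.2.2⟩

theorem comp_mem_irr_of_surjective {A B : Type*} [Group A] [Group B] {f : A →* B}
    (hf : Function.Surjective f) {χ : B → ℂ} (hχ : χ ∈ Irr B) : χ ∘ f ∈ Irr A := by
  obtain ⟨n, ρ, hρ, rfl⟩ := hχ
  have : Nontrivial (Fin n → ℂ) := by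
    by_contra h
    rw [not_nontrivial_iff_subsingleton] at h
    obtain ⟨W₁, W₂, hW⟩ := hρ.toNontrivial
    exact hW (Subrepresentation.toSubmodule_injective (Subsingleton.elim _ _))
  exact ⟨n, ρ.comp f, isIrreducible_comp_of_surjective hρ f hf, rfl⟩

theorem oddRestrictionProperty_mulEquiv {A B : Type*} [Group A] [Group B] (e : A ≃* B) :
    OddRestrictionProperty M (e : A →* B) := by
  intro χ hχ
  have hirr : χ ∘ e ∈ Irr A := comp_mem_irr_of_surjective (f := (e : A →* B)) e.surjective hχ.1
  have hcard : ∀ x, Nat.card (ConjClasses.mk x).carrier =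
      Nat.card (ConjClasses.mk (e x)).carrier := fun x => by
    refine Nat.card_congr (e.toEquiv.subtypeEquiv fun y => ?_)
    simp only [ConjClasses.mem_carrier_iff_mk_eq, ConjClasses.mk_eq_mk_iff_isConj, isConj_iff]
    exact ⟨fun ⟨c, hc⟩ => ⟨e c, by simp [← hc]⟩,
      fun ⟨c, hc⟩ => ⟨e.symm c, e.injective (by simpa using hc)⟩⟩
  refine ⟨⟨hirr, by simpa using hχ.2⟩, ?_, ?_⟩
  · refine (and_iff_right hχ.1).trans (Iff.trans ?_ (and_iff_right hirr).symm)
    unfold SameBlock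
    rw [e.surjective.forall]
    refine forall_congr' fun x => ?_
    simp [centralCharacter, hcard]
  · unfold SigmaFixed
    rw [e.surjective.forall]
    rfl

theorem oddRestrictionProperty_subtype_of_index_two {G : Type*} [Group G] [Finite G]
    {H : Subgroup G} (hH : H.index = 2) (hM : M.IsPrime) (h2 : 2 ∈ M) :
    OddRestrictionProperty M H.subtype := by
  have := Subgroup.normal_of_index_eq_two hH
  rintro χ ⟨⟨n, ρ, hρ, rfl⟩, d, hd, hd'⟩
  have hV : Odd (finrank ℂ (Fin n → ℂ)) := by
    rw [Representation.char_one] at hd'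
    exact (Nat.cast_injective hd' : _ = d) ▸ hd
  have hirr := isIrreducible_comp_subtype_of_index_two hρ hV hH
  have hirr' : Res H ρ.character ∈ Irr H := ⟨n, _, hirr, rfl⟩
  have hirrG : ρ.character ∈ Irr G := ⟨n, ρ, hρ, rfl⟩
  refine ⟨⟨hirr', d, hd, hd'⟩, ⟨fun h => ⟨hirr', ?_⟩, fun h => ⟨hirrG, ?_⟩⟩,
    fun h x => h x, sigmaFixed_of_sigmaFixed_res hV hirr hH hM h2⟩
  · exact sameBlock_one_res_of_sameBlock_one hV.pos.ne' hirr hH hM h2 h.2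
  · exact sameBlock_one_of_sameBlock_one_res hV hirr hH hM h2 h.2

theorem exists_index_two_of_index_eq_two_pow {G : Type*} [Group G] [Finite G] {N : Subgroup G}
    [N.Normal] {n : ℕ} (hN : N.index = 2 ^ (n + 1)) : ∃ H : Subgroup G, N ≤ H ∧ H.index = 2 := by
  have hcard : Nat.card (G ⧸ N) = 2 ^ (n + 1) := hN
  obtain ⟨K, hK⟩ := Sylow.exists_subgroup_card_pow_prime (G := G ⧸ N) 2 (n := n)
    (hcard ▸ pow_dvd_pow 2 n.le_succ)
  refine ⟨K.comap (QuotientGroup.mk' N), fun x hx => ?_, ?_⟩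
  · rw [Subgroup.mem_comap, QuotientGroup.mk'_apply, (QuotientGroup.eq_one_iff x).2 hx]
    exact K.one_mem
  · rw [Subgroup.index_comap_of_surjective _ (QuotientGroup.mk'_surjective N)]
    have := K.card_mul_index
    rw [hK, hcard, pow_succ] at this
    exact Nat.eq_of_mul_eq_mul_left (by positivity) this

/-- The group is quantified after the colon because the induction hypothesis is applied to `H`. The
last isomorphism in the composite identifies `N` with its copy inside `H`. -/
theorem oddRestrictionProperty_subtype_of_index_eq_two_pow (hM : M.IsPrime) (h2 : 2 ∈ M) (n : ℕ) :
    ∀ {G : Type*} [Group G] [Finite G] (N : Subgroup G) [N.Normal], N.index = 2 ^ n →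
      OddRestrictionProperty M N.subtype := by
  induction n with
  | zero =>
    intro G _ _ N _ hN
    rw [pow_zero, Subgroup.index_eq_one] at hN
    subst hN
    exact oddRestrictionProperty_mulEquiv Subgroup.topEquiv
  | succ n ih =>
    intro G _ _ N _ hN
    obtain ⟨H, hNH, hH⟩ := exists_index_two_of_index_eq_two_pow hN
    have hind : (N.subgroupOf H).index = 2 ^ n := by
      have := Subgroup.relIndex_mul_index hNH
      rw [hN, hH, pow_succ] at this
      exact Nat.eq_of_mul_eq_mul_right two_pos this
    exact ((oddRestrictionProperty_subtype_of_index_two hH hM h2).comp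
      (ih (N.subgroupOf H) hind)).comp
      (oddRestrictionProperty_mulEquiv (Subgroup.subgroupOfEquivOfLe hNH).symm)

end

end OddDegreeRestriction

theorem mainTheorem10 {G : Type*} [Group G] [Finite G] (N : Subgroup G) [N.Normal]
    (hN : IsPGroup 2 (G ⧸ N))
    (M : Ideal (integralClosure ℤ ℂ)) (hM : M.IsMaximal) (h2M : 2 ∈ M)
    (χ : G → ℂ) (hχ : χ ∈ OddDegreeRestriction.IrrOdd G) :
    OddDegreeRestriction.Res N χ ∈
        OddDegreeRestriction.IrrOdd N ∩ OddDegreeRestriction.Invariant N ∧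
      (χ ∈ OddDegreeRestriction.IrrOddB0 M G ↔
        OddDegreeRestriction.Res N χ ∈
          OddDegreeRestriction.IrrOddB0 M N ∩ OddDegreeRestriction.Invariant N) ∧
      (OddDegreeRestriction.SigmaFixed χ ↔
        OddDegreeRestriction.SigmaFixed (OddDegreeRestriction.Res N χ)) := by
  obtain ⟨n, hn⟩ := IsPGroup.iff_card.1 hN
  obtain ⟨h1, h2, h3⟩ := OddDegreeRestriction.oddRestrictionProperty_subtype_of_index_eq_two_pow
    hM.isPrime h2M n N hn χ hχ
  have hinv : OddDegreeRestriction.Res N χ ∈ OddDegreeRestriction.Invariant N := by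
    obtain ⟨⟨m, ρ, -, rfl⟩, -⟩ := hχ
    exact fun g x => ρ.char_conj x g
  exact ⟨⟨h1, hinv⟩, ⟨fun h => ⟨⟨h2.1 h.1, h1⟩, hinv⟩, fun h => ⟨h2.2 h.1.1, hχ⟩⟩, h3⟩
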